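/- Let $0<\alpha<1$ and $0<\beta\le 1$ with $\alpha\beta>\frac12$, and let $B=(B(t))_{t\in[0,1]}$ be a bifractional Brownian motion with parameters $\alpha,\beta$ on a probability space, i.e. a centred real Gaussian process with covariance $$\mathbb{E}[B(s)B(t)]=R(s,t)=\frac{1}{2^\beta}\left((t^{2\alpha}+s^{2\alpha})^\beta-|t-s|^{2\alpha\beta}\right),\qquad s,t\in[0,1],$$ whose sample paths are almost surely continuous. Let $\mathcal{E}$ be the linear span of the indicator functions $\mathbf{1}_{[0,t]}$, $t\in[0,1]$, with the inner product determined by $\langle \mathbf{1}_{[0,s]},\mathbf{1}_{[0,t]}\rangle_{\mathcal H}=R(s,t)$; let $\mathcal{H}$ be its Hilbert space completion (elements of seminorm zero being identified with $0$), and let $\varphi\mapsto B(\varphi)$ be the Wiener integral, i.e. the linear isometry from $\mathcal{H}$ into $L^2(\mathbb{P})$ that extends $\mathbf{1}_{[0,t]}\mapsto B(t)$. Let $(\varphi_n)_{n\ge1}$ be an orthonormal basis of $\mathcal{H}$. For $\gamma>0$ let $\mathcal{C}^\gamma$ be the space of continuous functions $f$ on $[0,1]$ with $$\|f\|_\gamma=\sup_{x}|f(x)|+\sup_{x\ne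 y}\frac{|f(x)-f(y)|}{|x-y|^\gamma}<\infty .$$ Then, almost surely, for every $\gamma$ with $0<\gamma<\alpha\beta$, the functions $$X_N(t)=\sum_{n=1}^{N}\langle\varphi_n,\mathbf{1}_{[0,t]}\rangle_{\mathcal H}\,B(\varphi_n)\qquad (N\ge1)$$ and the sample path $t\mapsto B(t)$ belong to $\mathcal{C}^\gamma$, and $\|X_N-B\|_\gamma\to0$ as $N\to\infty$. -/

import Mathlib

open MeasureTheory ProbabilityTheory Filter Topology
open scoped unitInterval NNReal ENNReal

/-! ### Bifractional Brownian motion on `[0, 1]` -/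

/-- The covariance kernel
`R(s, t) = 2^{-β} ((t^{2α} + s^{2α})^β - |t - s|^{2αβ})` for `s, t ∈ [0, 1]`. -/
noncomputable def bifractionalKernel (α β : ℝ) : Matrix I I ℝ := fun s t =>
  1 / (2 : ℝ) ^ β *
    (((t : ℝ) ^ (2 * α) + (s : ℝ) ^ (2 * α)) ^ β - |(t : ℝ) - (s : ℝ)| ^ (2 * α * β))

/-- `B` is a bifractional Brownian motion (indexed by `[0, 1]`) with parameters `α`, `β`: a centred
real Gaussian process with covariance function `R`. -/
structure IsBifractionalBrownianMotion {Ω : Type*} [MeasurableSpace Ω] (α β : ℝ)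
    (B : I → Ω → ℝ) (P : Measure Ω) : Prop where
  isGaussianProcess : IsGaussianProcess B P
  centred (t : I) : ∫ ω, B t ω ∂P = 0
  covariance_eq (s t : I) : cov[B s, B t; P] = bifractionalKernel α β s t

/-! ### Step functions and the completion `H` -/

/-- The indicator function `1_{[0, t]}`, as a function on `[0, 1]`. -/
noncomputable def stepFun (t : I) : I → ℝ := (Set.Icc 0 t).indicator 1

theorem stepFun_linearIndependent : LinearIndependent ℝ stepFun := by
  rw [linearIndependent_iff]
  intro c hc
  by_contra hne
  have hs : c.support.Nonempty := Finsupp.support_nonempty_iff.mpr hne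
  set t := c.support.max' hs with ht
  have htm : t ∈ c.support := Finset.max'_mem _ _
  have h := congrFun hc t
  rw [Finsupp.linearCombination_apply, Finsupp.sum, Finset.sum_apply,
    Finset.sum_eq_single t] at h
  · exact (Finsupp.mem_support_iff.mp htm) (by simpa [stepFun] using h)
  · intro s hs' hst
    have hlt : s < t := lt_of_le_of_ne (Finset.le_max' _ _ hs') hst
    have : t ∉ Set.Icc 0 s := fun hmem => absurd hmem.2 (not_le.mpr hlt)
    simp [stepFun, Set.indicator_of_notMem this]
  · intro h'
    exact absurd htm h'

/-- The linear space `E` generated by the indicators `1_{[0, t]}`, `t ∈ [0, 1]`. It is a separate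
type, tagged with the kernel `K` that defines its inner product. -/
def StepSpace (K : Matrix I I ℝ) (_hK : K.PosSemidef) : Type :=
  Submodule.span ℝ (Set.range stepFun)

namespace StepSpace

variable {K : Matrix I I ℝ} {hK : K.PosSemidef}

noncomputable instance : AddCommGroup (StepSpace K hK) :=
  inferInstanceAs (AddCommGroup (Submodule.span ℝ (Set.range stepFun)))

noncomputable instance : Module ℝ (StepSpace K hK) :=
  inferInstanceAs (Module ℝ (Submodule.span ℝ (Set.range stepFun)))

/-- The indicators `1_{[0, t]}` form a linear basis of `E`. -/
noncomputable def basis (K : Matrix I I ℝ) (hK : K.PosSemidef) :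
    Module.Basis I ℝ (StepSpace K hK) :=
  Module.Basis.span stepFun_linearIndependent

/-- The indicator `1_{[0, t]}` as an element of `E`. -/
noncomputable def ind (K : Matrix I I ℝ) (hK : K.PosSemidef) (t : I) : StepSpace K hK :=
  ⟨stepFun t, Submodule.subset_span ⟨t, rfl⟩⟩

theorem basis_apply (t : I) : basis K hK t = ind K hK t :=
  Module.Basis.span_apply stepFun_linearIndependent t

/-- The bilinear form on `E` with `⟨1_{[0, s]}, 1_{[0, t]}⟩ = K s t`. -/
noncomputable def form (K : Matrix I I ℝ) (hK : K.PosSemidef) :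
    StepSpace K hK →ₗ[ℝ] StepSpace K hK →ₗ[ℝ] ℝ :=
  (basis K hK).constr ℝ fun s => (basis K hK).constr ℝ fun t => K s t

theorem form_apply (f g : StepSpace K hK) :
    form K hK f g = ((basis K hK).repr f).sum fun s a =>
      ((basis K hK).repr g).sum fun t b => a * K s t * b := by
  simp only [form, Module.Basis.constr_apply, Finsupp.sum, LinearMap.sum_apply,
    LinearMap.smul_apply, smul_eq_mul, Finset.mul_sum]
  refine Finset.sum_congr rfl fun s _ => Finset.sum_congr rfl fun t _ => ?_
  ring

theorem form_symm (f g : StepSpace K hK) : form K hK f g = form K hK g f := by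
  rw [form_apply, form_apply, Finsupp.sum_comm]
  refine Finsupp.sum_congr fun s _ => Finsupp.sum_congr fun t _ => ?_
  have h : K s t = K t s := by simpa using congrFun (congrFun hK.1 t) s
  rw [← h]
  ring

/-- The (possibly degenerate) inner product on `E`; `inner_ind` below identifies it. -/
noncomputable instance core : PreInnerProductSpace.Core ℝ (StepSpace K hK) where
  inner f g := form K hK f g
  conj_inner_symm f g := by simpa using form_symm g f
  re_inner_nonneg f := by
    have h := hK.2 ((basis K hK).repr f)
    simpa [form_apply] using h
  add_left f g h := by simp
  smul_left f g r := by simp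

noncomputable instance : SeminormedAddCommGroup (StepSpace K hK) :=
  InnerProductSpace.Core.toSeminormedAddCommGroup (𝕜 := ℝ)

noncomputable instance : InnerProductSpace ℝ (StepSpace K hK) := .ofCore core

theorem inner_ind (s t : I) : inner ℝ (ind K hK s) (ind K hK t) = K s t := by
  change form K hK (ind K hK s) (ind K hK t) = K s t
  rw [← basis_apply, ← basis_apply]
  simp [form]

end StepSpace

/-- The Hilbert space `H`: the completion of `E` with respect to the inner product determined by
`⟨1_{[0, s]}, 1_{[0, t]}⟩ = R(s, t)`. -/
abbrev BifractionalHilbert (α β : ℝ) (hR : (bifractionalKernel α β).PosSemidef) : Type :=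
  UniformSpace.Completion (StepSpace (bifractionalKernel α β) hR)

/-- The class of the indicator `1_{[0, t]}` in `H`. -/
noncomputable def BifractionalHilbert.ind {α β : ℝ} (hR : (bifractionalKernel α β).PosSemidef)
    (t : I) : BifractionalHilbert α β hR :=
  ((StepSpace.ind _ hR t : StepSpace (bifractionalKernel α β) hR) : BifractionalHilbert α β hR)

/-! ### The Wiener integral -/

namespace IsBifractionalBrownianMotion

variable {Ω : Type*} [MeasurableSpace Ω] {α β : ℝ} {B : I → Ω → ℝ} {P : Measure Ω}

theorem memLp (hB : IsBifractionalBrownianMotion α β B P) (t : I) : MemLp (B t) 2 P :=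
  ((hB.isGaussianProcess.hasGaussianLaw {t}).eval ⟨t, by simp⟩).memLp_two

theorem inner_toLp (hB : IsBifractionalBrownianMotion α β B P) (s t : I) :
    inner ℝ ((hB.memLp s).toLp (B s)) ((hB.memLp t).toLp (B t)) = bifractionalKernel α β s t := by
  have := hB.isGaussianProcess.isProbabilityMeasure
  rw [← hB.covariance_eq s t, covariance_eq_sub (hB.memLp s) (hB.memLp t), hB.centred s,
    zero_mul, sub_zero, L2.inner_def]
  refine integral_congr_ae ?_
  filter_upwards [(hB.memLp s).coeFn_toLp, (hB.memLp t).coeFn_toLp] with ω h1 h2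
  simp [h1, h2, mul_comm]

/-- The covariance kernel of a process is positive semidefinite. -/
theorem posSemidef (hB : IsBifractionalBrownianMotion α β B P) :
    (bifractionalKernel α β).PosSemidef := by
  refine ⟨?_, fun x => ?_⟩
  · ext s t
    rw [Matrix.conjTranspose_apply, star_trivial, ← hB.inner_toLp, ← hB.inner_toLp,
      real_inner_comm]
  · have h : (x.sum fun s a => x.sum fun t b => star a * bifractionalKernel α β s t * b) =
        inner ℝ (x.sum fun s a => a • (hB.memLp s).toLp (B s))
          (x.sum fun s a => a • (hB.memLp s).toLp (B s)) := by
      simp only [Finsupp.sum, sum_inner, inner_sum, real_inner_smul_left, real_inner_smul_right,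
        hB.inner_toLp, star_trivial]
      rw [Finset.sum_comm]
      refine Finset.sum_congr rfl fun s _ => Finset.sum_congr rfl fun t _ => ?_
      ring
    rw [h]
    exact real_inner_self_nonneg

/-- The Hilbert space `H` attached to the covariance function of `B`. -/
abbrev H (hB : IsBifractionalBrownianMotion α β B P) : Type :=
  BifractionalHilbert α β hB.posSemidef

/-- The element `1_{[0, t]}` of `H`. -/
noncomputable abbrev ind (hB : IsBifractionalBrownianMotion α β B P) (t : I) : hB.H :=
  BifractionalHilbert.ind hB.posSemidef t

/-- The linear map `∑ aᵢ 1_{[0, tᵢ]} ↦ ∑ aᵢ B(tᵢ)` from `E` to `L²(P)`. -/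
noncomputable def stepIntegral (hB : IsBifractionalBrownianMotion α β B P) :
    StepSpace (bifractionalKernel α β) hB.posSemidef →ₗ[ℝ] Lp ℝ 2 P :=
  (StepSpace.basis _ hB.posSemidef).constr ℝ fun t => (hB.memLp t).toLp (B t)

theorem inner_stepIntegral (hB : IsBifractionalBrownianMotion α β B P)
    (f g : StepSpace (bifractionalKernel α β) hB.posSemidef) :
    inner ℝ (hB.stepIntegral f) (hB.stepIntegral g) = inner ℝ f g := by
  change _ = StepSpace.form _ _ f g
  rw [StepSpace.form_apply]
  simp only [stepIntegral, Module.Basis.constr_apply, Finsupp.sum, sum_inner, inner_sum,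
    real_inner_smul_left, real_inner_smul_right, hB.inner_toLp]
  rw [Finset.sum_comm]
  refine Finset.sum_congr rfl fun s _ => Finset.sum_congr rfl fun t _ => ?_
  ring

/-- The map `∑ aᵢ 1_{[0, tᵢ]} ↦ ∑ aᵢ B(tᵢ)` as a linear isometry. -/
noncomputable def stepIsometry (hB : IsBifractionalBrownianMotion α β B P) :
    StepSpace (bifractionalKernel α β) hB.posSemidef →ₗᵢ[ℝ] Lp ℝ 2 P where
  toLinearMap := hB.stepIntegral
  norm_map' f := by
    have h := hB.inner_stepIntegral f f
    rw [real_inner_self_eq_norm_sq, real_inner_self_eq_norm_sq] at h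
    exact (pow_left_inj₀ (norm_nonneg _) (norm_nonneg _) two_ne_zero).mp h

/-- The Wiener integral `φ ↦ B(φ)`: the continuous extension to `H` of the isometry
`1_{[0, t]} ↦ B(t)` with values in `L²(P)`. -/
noncomputable def wienerIntegral (hB : IsBifractionalBrownianMotion α β B P) :
    hB.H →L[ℝ] Lp ℝ 2 P :=
  hB.stepIsometry.toContinuousLinearMap.extend UniformSpace.Completion.toComplL

theorem wienerIntegral_coe (hB : IsBifractionalBrownianMotion α β B P)
    (f : StepSpace (bifractionalKernel α β) hB.posSemidef) :
    hB.wienerIntegral (f : hB.H) = hB.stepIntegral f :=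
  ContinuousLinearMap.extend_eq _ UniformSpace.Completion.denseRange_coe
    (UniformSpace.Completion.isUniformInducing_coe _) f

theorem wienerIntegral_ind (hB : IsBifractionalBrownianMotion α β B P) (t : I) :
    hB.wienerIntegral (hB.ind t) = (hB.memLp t).toLp (B t) := by
  rw [ind, BifractionalHilbert.ind, wienerIntegral_coe, stepIntegral, ← StepSpace.basis_apply,
    Module.Basis.constr_basis]

theorem norm_wienerIntegral (hB : IsBifractionalBrownianMotion α β B P) (φ : hB.H) :
    ‖hB.wienerIntegral φ‖ = ‖φ‖ := by
  refine UniformSpace.Completion.induction_on φ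
    (isClosed_eq (by fun_prop) (by fun_prop)) fun f => ?_
  rw [wienerIntegral_coe, UniformSpace.Completion.norm_coe]
  exact hB.stepIsometry.norm_map f

/-- The partial sum `t ↦ ∑_{n < N} ⟨φₙ, 1_{[0, t]}⟩ B(φₙ)(ω)`. -/
noncomputable def partialSum (hB : IsBifractionalBrownianMotion α β B P) (φ : ℕ → hB.H)
    (N : ℕ) (ω : Ω) (t : I) : ℝ :=
  ∑ n ∈ Finset.range N, inner ℝ (φ n) (hB.ind t) * hB.wienerIntegral (φ n) ω

end IsBifractionalBrownianMotion

/-! ### Hölder spaces on `[0, 1]` -/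

/-- The Hölder space `C^γ([0, 1])`, as a set of functions. -/
def holderSpace (γ : ℝ≥0) : Set (I → ℝ) := {f | Continuous f ∧ MemHolder γ f}

/-- The Hölder norm `sup |f| + sup_{x ≠ y} |f x - f y| / |x - y|^γ`, with values in `[0, ∞]`. -/
noncomputable def holderENorm (γ : ℝ≥0) (f : I → ℝ) : ℝ≥0∞ :=
  (⨆ x, ‖f x‖ₑ) + eHolderNorm γ f

/-- `u N → f` in `C^γ([0, 1])`: all functions belong to the space and `‖u N - f‖_γ → 0`. -/
def TendstoHolder (γ : ℝ≥0) (u : ℕ → I → ℝ) (f : I → ℝ) : Prop :=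
  (∀ N, u N ∈ holderSpace γ) ∧ f ∈ holderSpace γ ∧
    Tendsto (fun N => holderENorm γ (u N - f)) atTop (𝓝 0)

/-! For fixed `h` in `H`, the sums `∑_{n<N} ⟨φₙ, h⟩ B(φₙ)` are Wiener integrals of the projections
of `h` onto the span of the first `N` basis vectors. The `B(φₙ)` are jointly Gaussian and
uncorrelated, hence independent, so these sums form a martingale in `N`. It converges almost surely,
and its limit is `B(h)` because the sums also converge to `B(h)` in `L²`. This gives pointwise
convergence at every dyadic time.

The main point is a Hölder bound uniform in `N`. Concavity of `x ↦ x^β` gives `‖1_{[0,s]} -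
1_{[0,t]}‖² ≤ 2 |s - t|^{2αβ}`. By Bessel's inequality, the Gaussian `p`-th moments of all partial
sums of an increment are at most a constant times `|s - t|^{αβp}`. Doob's maximal inequality puts
the supremum over `N` inside the probability. For large even `p` a union bound over the `2^n` dyadic
intervals of level `n` is summable in `n`, so Borel–Cantelli and Kolmogorov chaining give a random
`r`-Hölder constant common to all `X_N`, for each `r < αβ`.

The rest is deterministic: a uniform `r`-Hölder bound and convergence on a dense set give uniform
convergence by equicontinuity, and interpolation between the sup norm and the `r`-Hölder seminorm
gives convergence in `C^γ` for `γ < r`. -/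

/-! ### Hölder continuity from dyadic increments -/

/-- The dyadic point `min (k / 2 ^ n) 1` of the unit interval. -/
noncomputable def dyadicPoint (n k : ℕ) : I :=
  Set.projIcc 0 1 zero_le_one ((k : ℝ) / 2 ^ n)

theorem coe_dyadicPoint {n k : ℕ} (hk : k ≤ 2 ^ n) : (dyadicPoint n k : ℝ) = k / 2 ^ n := by
  have hk' : (k : ℝ) ≤ 2 ^ n := by exact_mod_cast hk
  rw [dyadicPoint, Set.projIcc_of_mem]
  exact ⟨by positivity, (div_le_one (by positivity)).2 hk'⟩

theorem dyadicPoint_of_le {n k : ℕ} (hk : 2 ^ n ≤ k) : dyadicPoint n k = 1 := by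
  have hk' : (2 : ℝ) ^ n ≤ k := by exact_mod_cast hk
  exact Set.projIcc_of_right_le _ ((one_le_div (by positivity)).2 hk')

theorem dyadicPoint_succ_two_mul (n k : ℕ) : dyadicPoint (n + 1) (2 * k) = dyadicPoint n k := by
  rw [dyadicPoint, dyadicPoint]
  congr 1
  push_cast
  rw [pow_succ]
  field_simp

theorem abs_coe_dyadicPoint_floor_sub_le (t : I) (n : ℕ) :
    |(dyadicPoint n ⌊2 ^ n * (t : ℝ)⌋₊ : ℝ) - t| ≤ (1 / 2) ^ n := by
  have hp : (0 : ℝ) < 2 ^ n := by positivity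
  have h0 : 0 ≤ 2 ^ n * (t : ℝ) := mul_nonneg hp.le t.2.1
  have hle : ⌊2 ^ n * (t : ℝ)⌋₊ ≤ 2 ^ n := by
    refine Nat.floor_le_of_le ?_
    push_cast
    nlinarith [t.2.2]
  rw [coe_dyadicPoint hle, one_div, inv_pow, abs_le]
  have h1 := Nat.floor_le h0
  have h2 := Nat.lt_floor_add_one (2 ^ n * (t : ℝ))
  constructor
  · rw [neg_le_sub_iff_le_add, ← one_div, ← add_div, le_div_iff₀ hp]
    linarith
  · rw [sub_le_iff_le_add, div_le_iff₀ hp, add_mul, inv_mul_cancel₀ hp.ne']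
    linarith

theorem tendsto_dyadicPoint_floor (t : I) :
    Tendsto (fun n : ℕ => dyadicPoint n ⌊2 ^ n * (t : ℝ)⌋₊) atTop (𝓝 t) := by
  rw [tendsto_iff_dist_tendsto_zero]
  refine squeeze_zero (fun _ => dist_nonneg) (abs_coe_dyadicPoint_floor_sub_le t) ?_
  exact tendsto_pow_atTop_nhds_zero_of_lt_one (by norm_num) (by norm_num)

theorem dense_range_dyadicPoint : Dense (Set.range fun p : ℕ × ℕ => dyadicPoint p.1 p.2) :=
  fun t => mem_closure_of_tendsto (tendsto_dyadicPoint_floor t)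
    (Eventually.of_forall fun n => ⟨(n, _), rfl⟩)

theorem dist_le_of_natDist_le_one {f : I → ℝ} {n : ℕ} {C : ℝ} (hC : 0 ≤ C)
    (h : ∀ k, dist (f (dyadicPoint n k)) (f (dyadicPoint n (k + 1))) ≤ C) {j k : ℕ}
    (hjk : j ≤ k + 1) (hkj : k ≤ j + 1) :
    dist (f (dyadicPoint n j)) (f (dyadicPoint n k)) ≤ C := by
  obtain rfl | rfl | rfl : j = k ∨ j = k + 1 ∨ k = j + 1 := by omega
  · simpa using hC
  · rw [dist_comm]; exact h k
  · exact h j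

/-- Chaining: `⌊2^(n+1) t⌋` is `2⌊2^n t⌋` or its successor, so successive dyadic approximations of
`t` agree or are neighbours at the finer level. The increments sum to a geometric tail. -/
theorem dist_dyadicPoint_floor_le {f : I → ℝ} (hf : Continuous f) {K q : ℝ} (hK : 0 ≤ K)
    (hq : 0 < q) (hq1 : q < 1)
    (h : ∀ n k, dist (f (dyadicPoint n k)) (f (dyadicPoint n (k + 1))) ≤ K * q ^ n)
    (t : I) (n : ℕ) :
    dist (f (dyadicPoint n ⌊2 ^ n * (t : ℝ)⌋₊)) (f t) ≤ K * q ^ n / (1 - q) := by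
  refine dist_le_of_le_geometric_of_tendsto q K hq1 (fun n => ?_)
    ((hf.tendsto t).comp (tendsto_dyadicPoint_floor t)) n
  have hstep : K * q ^ (n + 1) ≤ K * q ^ n :=
    mul_le_mul_of_nonneg_left (pow_le_pow_of_le_one hq.le hq1.le n.le_succ) hK
  refine le_trans ?_ hstep
  have h0 : 0 ≤ 2 ^ n * (t : ℝ) := mul_nonneg (by positivity) t.2.1
  have h1 := Nat.floor_le h0
  have h2 := Nat.lt_floor_add_one (2 ^ n * (t : ℝ))
  simp only [Function.comp_apply]
  rw [← dyadicPoint_succ_two_mul]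
  have hpow : 2 ^ (n + 1) * (t : ℝ) = 2 * (2 ^ n * (t : ℝ)) := by ring
  have hn : 0 ≤ 2 ^ (n + 1) * (t : ℝ) := mul_nonneg (by positivity) t.2.1
  refine dist_le_of_natDist_le_one (by positivity) (h (n + 1)) ?_ ?_
  · refine le_trans (Nat.le_floor ?_) (Nat.le_succ _)
    rw [hpow]
    push_cast
    linarith
  · refine Nat.le_of_lt_succ ((Nat.floor_lt hn).2 ?_)
    rw [hpow]
    push_cast
    linarith

/-- A continuous function on `[0, 1]` whose increments over dyadic intervals of length `2 ^ (-n)`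
are at most `K * 2 ^ (-γ n)` is `γ`-Hölder with a constant proportional to `K`. -/
theorem exists_holderWith_of_dyadic {γ : ℝ≥0} (hγ : 0 < γ) :
    ∃ C : ℝ≥0, ∀ (f : I → ℝ) (K : ℝ≥0), Continuous f →
      (∀ n k, k < 2 ^ n → dist (f (dyadicPoint n k)) (f (dyadicPoint n (k + 1))) ≤
        K * ((1 / 2 : ℝ) ^ (γ : ℝ)) ^ n) → HolderWith (C * K) γ f := by
  set q : ℝ := (1 / 2 : ℝ) ^ (γ : ℝ) with hq
  have hq0 : 0 < q := by positivity
  have hq1 : q < 1 := Real.rpow_lt_one (by norm_num) (by norm_num) (by exact_mod_cast hγ)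
  have h1q : 0 < 1 - q := by linarith
  have hC0 : 0 ≤ q⁻¹ * (1 + 2 / (1 - q)) := by positivity
  -- One step between neighbours costs `K q^m`, the two chains to `s` and `t` cost `K q^m / (1 - q)`
  -- each, and `q⁻¹` turns `q^m` into `q^(m+1)`, which is at most `dist s t ^ γ`.
  refine ⟨⟨q⁻¹ * (1 + 2 / (1 - q)), hC0⟩, fun f K hf h => ?_⟩
  have h' : ∀ n k, dist (f (dyadicPoint n k)) (f (dyadicPoint n (k + 1))) ≤ K * q ^ n := by
    intro n k
    rcases lt_or_ge k (2 ^ n) with hk | hk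
    · exact h n k hk
    · rw [dyadicPoint_of_le hk, dyadicPoint_of_le (hk.trans k.le_succ), dist_self]
      positivity
  intro s t
  rcases eq_or_ne s t with rfl | hst
  · simp
  have hpos : 0 < dist s t := dist_pos.2 hst
  have hle1 : dist s t ≤ 1 := by
    rw [Subtype.dist_eq, Real.dist_eq, abs_le]
    constructor <;> linarith [s.2.1, s.2.2, t.2.1, t.2.2]
  -- The scale of the pair: `2^(-(m+1)) < dist s t ≤ 2^(-m)`, so the level-`m` floors of `s` and `t`
  -- differ by at most one.
  obtain ⟨m, hm1, hm2⟩ := exists_nat_pow_near_of_lt_one hpos hle1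
    (by norm_num : (0 : ℝ) < 1 / 2) (by norm_num)
  have hmid : dist (f (dyadicPoint m ⌊2 ^ m * (s : ℝ)⌋₊)) (f (dyadicPoint m ⌊2 ^ m * (t : ℝ)⌋₊))
      ≤ K * q ^ m := by
    have hd : |2 ^ m * (s : ℝ) - 2 ^ m * (t : ℝ)| ≤ 1 := by
      rw [← mul_sub, abs_mul, abs_of_pos (by positivity : (0 : ℝ) < 2 ^ m)]
      rw [Subtype.dist_eq, Real.dist_eq, one_div, inv_pow] at hm2
      calc (2 : ℝ) ^ m * |(s : ℝ) - t| ≤ 2 ^ m * (2 ^ m)⁻¹ := by gcongr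
        _ = 1 := mul_inv_cancel₀ (by positivity)
    rw [abs_le] at hd
    have key : ∀ a b : ℝ, 0 ≤ a → a ≤ b + 1 → 0 ≤ b → ⌊a⌋₊ ≤ ⌊b⌋₊ + 1 := by
      intro a b _ hab hb
      rw [← Nat.floor_add_one hb]
      exact Nat.floor_le_floor hab
    have hs0 : 0 ≤ 2 ^ m * (s : ℝ) := mul_nonneg (by positivity) s.2.1
    have ht0 : 0 ≤ 2 ^ m * (t : ℝ) := mul_nonneg (by positivity) t.2.1
    exact dist_le_of_natDist_le_one (by positivity) (h' m)
      (key _ _ hs0 (by linarith) ht0) (key _ _ ht0 (by linarith) hs0)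
  have hsm := dist_dyadicPoint_floor_le hf K.2 hq0 hq1 h' s m
  have htm := dist_dyadicPoint_floor_le hf K.2 hq0 hq1 h' t m
  have hqm : q ^ (m + 1) ≤ dist s t ^ (γ : ℝ) := by
    have : q ^ (m + 1) = ((1 / 2 : ℝ) ^ (m + 1)) ^ (γ : ℝ) := by
      rw [hq, ← Real.rpow_natCast, ← Real.rpow_natCast, ← Real.rpow_mul (by norm_num),
        ← Real.rpow_mul (by norm_num), mul_comm]
    rw [this]
    exact Real.rpow_le_rpow (by positivity) hm1.le γ.2
  have hreal : dist (f s) (f t) ≤ q⁻¹ * (1 + 2 / (1 - q)) * K * dist s t ^ (γ : ℝ) := by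
    calc dist (f s) (f t) ≤ dist (f s) (f (dyadicPoint m ⌊2 ^ m * (s : ℝ)⌋₊)) +
          dist (f (dyadicPoint m ⌊2 ^ m * (s : ℝ)⌋₊)) (f (dyadicPoint m ⌊2 ^ m * (t : ℝ)⌋₊)) +
          dist (f (dyadicPoint m ⌊2 ^ m * (t : ℝ)⌋₊)) (f t) := dist_triangle4 _ _ _ _
      _ ≤ K * q ^ m / (1 - q) + K * q ^ m + K * q ^ m / (1 - q) := by
        rw [dist_comm (f s)]
        exact add_le_add (add_le_add hsm hmid) htm
      _ = q⁻¹ * (1 + 2 / (1 - q)) * K * q ^ (m + 1) := by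
        rw [pow_succ]
        field_simp
        ring
      _ ≤ _ := by gcongr
  rw [edist_dist, edist_dist, ENNReal.ofReal_rpow_of_pos hpos, ← ENNReal.ofReal_coe_nnreal,
    ← ENNReal.ofReal_mul (by positivity)]
  exact ENNReal.ofReal_le_ofReal hreal

/-! ### Convergence in Hölder spaces -/

/-- The Hölder inequality for a continuous `f` is a closed condition on pairs, and on `S ×ˢ S` it
passes to the limit. -/
theorem HolderWith.of_tendsto_of_dense {X : Type*} [PseudoMetricSpace X] {C r : ℝ≥0}
    {u : ℕ → X → ℝ} {f : X → ℝ} {S : Set X} (hS : Dense S) (hu : ∀ N, HolderWith C r (u N))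
    (hf : Continuous f) (h : ∀ x ∈ S, Tendsto (u · x) atTop (𝓝 (f x))) :
    HolderWith C r f := by
  have hcl : IsClosed {p : X × X | edist (f p.1) (f p.2) ≤ C * edist p.1 p.2 ^ (r : ℝ)} := by
    refine isClosed_le ((hf.comp continuous_fst).edist (hf.comp continuous_snd)) ?_
    exact (ENNReal.continuous_const_mul ENNReal.coe_ne_top).comp
      (ENNReal.continuous_rpow_const.comp continuous_edist)
  have hsub : S ×ˢ S ⊆ {p : X × X | edist (f p.1) (f p.2) ≤ C * edist p.1 p.2 ^ (r : ℝ)} := by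
    rintro ⟨x, y⟩ ⟨hx, hy⟩
    exact le_of_tendsto ((h x hx).edist (h y hy)) (Eventually.of_forall fun N => hu N x y)
  intro x y
  exact hcl.closure_subset_iff.2 hsub ((hS.prod hS) (x, y))

/-- The Arzelà–Ascoli mechanism: a common Hölder bound is equicontinuity, which extends convergence
from `S` to all points and, by compactness, makes it uniform. -/
theorem tendstoUniformly_of_holderWith {X : Type*} [PseudoMetricSpace X] [CompactSpace X]
    {C r : ℝ≥0} {u : ℕ → X → ℝ} {f : X → ℝ} {S : Set X} (hS : Dense S)
    (hu : ∀ N, HolderWith C r (u N)) (hr : 0 < r) (hf : Continuous f)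
    (h : ∀ x ∈ S, Tendsto (u · x) atTop (𝓝 (f x))) : TendstoUniformly u f atTop := by
  have heq : Equicontinuous u := by
    refine Metric.equicontinuous_of_continuity_modulus (fun d => C * d ^ (r : ℝ)) ?_ u
      fun x y N => (hu N).dist_le x y
    have hr' : (r : ℝ) ≠ 0 := by exact_mod_cast hr.ne'
    have : Continuous fun d : ℝ => C * d ^ (r : ℝ) :=
      continuous_const.mul (continuous_id.rpow_const fun _ => Or.inr r.2)
    simpa [Real.zero_rpow hr'] using this.tendsto 0
  refine UniformFun.tendsto_iff_tendstoUniformly.1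
    ((heq.tendsto_uniformFun_iff_pi atTop f).2 (tendsto_pi_nhds.2 fun x => ?_))
  exact (heq.isClosed_setOfPred_tendsto hf).closure_subset_iff.2 h (hS x)

/-- A sup bound `ε` is a `0`-Hölder bound `2ε`; the geometric mean of this and the `r`-Hölder bound,
with weights `1 - s/r` and `s/r`, is an `s`-Hölder bound. For `s < r` it tends to zero with `ε`. -/
theorem HolderWith.holderWith_of_forall_enorm_le {X : Type*} [PseudoMetricSpace X]
    {C r s ε : ℝ≥0} {f : X → ℝ} (hf : HolderWith C r f) (hε : ∀ x, ‖f x‖ₑ ≤ ε)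
    (hr : 0 < r) (hsr : s ≤ r) :
    HolderWith ((2 * ε) ^ ((1 - s / r : ℝ≥0) : ℝ) * C ^ ((s / r : ℝ≥0) : ℝ)) s f := by
  have h0 : HolderWith (2 * ε) 0 f := by
    intro x y
    calc edist (f x) (f y) = ‖f x - f y‖ₑ := edist_eq_enorm_sub _ _
      _ ≤ ‖f x‖ₑ + ‖f y‖ₑ := enorm_sub_le
      _ ≤ ε + ε := add_le_add (hε x) (hε y)
      _ = _ := by simp [two_mul]
  have h1 : s / r ≤ 1 := div_le_one_of_le₀ hsr zero_le
  have h := h0.interpolate hf (tsub_add_cancel_of_le h1)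
  rwa [zero_mul, zero_add, mul_div_cancel₀ _ hr.ne'] at h

/-- Pointwise convergence on a dense set of uniformly `r`-Hölder functions to a continuous function
implies convergence in the Hölder spaces of smaller exponent. -/
theorem tendstoHolder_of_holderWith {C r s : ℝ≥0} {u : ℕ → I → ℝ} {f : I → ℝ} {S : Set I}
    (hS : Dense S) (hu : ∀ N, HolderWith C r (u N)) (hs : 0 < s) (hsr : s < r)
    (hf : Continuous f) (h : ∀ x ∈ S, Tendsto (u · x) atTop (𝓝 (f x))) :
    TendstoHolder s u f := by
  have hr : 0 < r := hs.trans hsr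
  have hfr : HolderWith C r f := .of_tendsto_of_dense hS hu hf h
  have hmem : ∀ {g : I → ℝ}, HolderWith C r g → g ∈ holderSpace s := fun hg =>
    ⟨hg.continuous hr, hg.memHolder.of_le hsr.le⟩
  refine ⟨fun N => hmem (hu N), hmem hfr, ?_⟩
  have hunif := tendstoUniformly_of_holderWith hS hu hr hf h
  have hsub : ∀ N, HolderWith (C + C) r (u N - f) := by
    intro N
    have := (hu N).add (by simpa using hfr.smul (-1 : ℝ) : HolderWith C r (-f))
    simpa [sub_eq_add_neg] using this
  -- `b ε` bounds the whole `s`-Hölder norm of `u N - f` as soon as its sup norm is at most `ε`.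
  set b : ℝ≥0 → ℝ≥0 := fun ε =>
    ε + (2 * ε) ^ ((1 - s / r : ℝ≥0) : ℝ) * (C + C) ^ ((s / r : ℝ≥0) : ℝ) with hb
  have hexp : (0 : ℝ) < ((1 - s / r : ℝ≥0) : ℝ) := by
    have : s / r < 1 := (div_lt_one hr).2 hsr
    exact_mod_cast tsub_pos_of_lt this
  have hb0 : Tendsto b (𝓝 0) (𝓝 0) := by
    have hc : Continuous b := continuous_id.add
      ((NNReal.continuous_rpow_const hexp.le |>.comp (continuous_const.mul continuous_id)).mul
        continuous_const)
    simpa [hb, NNReal.zero_rpow hexp.ne'] using hc.tendsto 0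
  rw [ENNReal.tendsto_nhds_zero]
  intro δ hδ
  obtain ⟨δ', hδ', hδδ⟩ := ENNReal.lt_iff_exists_nnreal_btwn.1 hδ
  have hev : ∀ᶠ ε in 𝓝[>] (0 : ℝ≥0), b ε ≤ δ' :=
    (hb0.mono_left nhdsWithin_le_nhds).eventually_le_const (by exact_mod_cast hδ')
  obtain ⟨ε, hε, hε0⟩ := (hev.and self_mem_nhdsWithin).exists
  filter_upwards [Metric.tendstoUniformly_iff.1 hunif ε (by exact_mod_cast hε0)] with N hN
  have hle : ∀ x, ‖(u N - f) x‖ₑ ≤ ε := by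
    intro x
    have := (hN x).le
    rw [dist_comm, dist_eq_norm] at this
    rw [enorm_le_coe]
    exact_mod_cast this
  calc holderENorm s (u N - f) ≤ ε + ↑((2 * ε) ^ ((1 - s / r : ℝ≥0) : ℝ) *
        (C + C) ^ ((s / r : ℝ≥0) : ℝ)) := by
        refine add_le_add (iSup_le hle) ?_
        exact ((hsub N).holderWith_of_forall_enorm_le hle hr hsr.le).eHolderNorm_le
    _ = (b ε : ℝ≥0∞) := by rw [hb]; push_cast; rfl
    _ ≤ δ' := by exact_mod_cast hε
    _ ≤ δ := hδδ.le

/-! ### Maximal inequality for martingales -/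

section Martingale

variable {Ω : Type*} {mΩ : MeasurableSpace Ω} {P : Measure Ω}

/-- The sum runs to `N` inclusive because the natural filtration at time `N` already knows `ξ N`;
the next increment is independent of it and centred. -/
theorem ProbabilityTheory.iIndepFun.martingale_sum_range_succ {ξ : ℕ → Ω → ℝ}
    (hm : ∀ n, StronglyMeasurable (ξ n)) (hξ : iIndepFun ξ P) (hint : ∀ n, Integrable (ξ n) P)
    (h0 : ∀ n, ∫ ω, ξ n ω ∂P = 0) :
    Martingale (fun N ω => ∑ k ∈ Finset.range (N + 1), ξ k ω) (Filtration.natural ξ hm) P := by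
  have := hξ.isProbabilityMeasure
  have hadp : StronglyAdapted (Filtration.natural ξ hm)
      fun N ω => ∑ k ∈ Finset.range (N + 1), ξ k ω := fun N =>
    Finset.stronglyMeasurable_fun_sum _ fun k hk =>
      (Filtration.stronglyAdapted_natural hm k).mono
        ((Filtration.natural ξ hm).mono (Finset.mem_range_succ_iff.1 hk))
  have hintS : ∀ N, Integrable (fun ω => ∑ k ∈ Finset.range (N + 1), ξ k ω) P :=
    fun N => integrable_finsetSum _ fun k _ => hint k
  refine martingale_nat hadp hintS fun N => ?_
  have hsum : (fun ω => ∑ k ∈ Finset.range (N + 1 + 1), ξ k ω) =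
      (fun ω => ∑ k ∈ Finset.range (N + 1), ξ k ω) + ξ (N + 1) := by
    ext ω
    simp [Finset.sum_range_succ _ (N + 1)]
  rw [hsum]
  have h1 := condExp_add (hintS N) (hint (N + 1)) (Filtration.natural ξ hm N)
  have h2 := hξ.condExp_natural_ae_eq_of_lt hm (Nat.lt_succ_self N)
  rw [condExp_of_stronglyMeasurable ((Filtration.natural ξ hm).le N) (hadp N) (hintS N)] at h1
  filter_upwards [h1, h2] with ω h1 h2
  rw [h1, Pi.add_apply, h2, h0, add_zero]

/-- Conditional Jensen inequality for the convex function `x ↦ x ^ p`. -/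
theorem MeasureTheory.Martingale.submartingale_pow [IsFiniteMeasure P] {𝒢 : Filtration ℕ mΩ}
    {f : ℕ → Ω → ℝ} (hf : Martingale f 𝒢 P) {p : ℕ} (hp : Even p)
    (hint : ∀ n, Integrable (fun ω => f n ω ^ p) P) :
    Submartingale (fun n ω => f n ω ^ p) 𝒢 P := by
  refine submartingale_nat (fun n => (hf.stronglyAdapted n).pow p) hint fun n => ?_
  have h1 := hp.convexOn_pow.map_condExp_le_univ (m := 𝒢 n) (𝒢.le n)
    (continuous_pow p).lowerSemicontinuous (hf.integrable (n + 1)) (hint (n + 1))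
  filter_upwards [h1, hf.condExp_ae_eq n.le_succ] with ω h1 h2
  rw [Function.comp_apply, h2] at h1
  exact h1

/-- The weak-type maximal inequality for the `p`-th moments of a martingale. -/
theorem MeasureTheory.Martingale.measure_exists_lt_abs_le [IsFiniteMeasure P]
    {𝒢 : Filtration ℕ mΩ} {f : ℕ → Ω → ℝ} (hf : Martingale f 𝒢 P) {p : ℕ} (hp : Even p)
    (hint : ∀ n, Integrable (fun ω => f n ω ^ p) P) {C : ℝ}
    (hC : ∀ n, ∫ ω, f n ω ^ p ∂P ≤ C) {l : ℝ} (hl : 0 < l) :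
    P {ω | ∃ n, l < |f n ω|} ≤ ENNReal.ofReal (C / l ^ p) := by
  have hsub := hf.submartingale_pow hp hint
  have hunion : {ω | ∃ n, l < |f n ω|} = ⋃ n, {ω | ∃ k ≤ n, l < |f k ω|} := by
    ext ω
    simp only [Set.mem_ofPred_eq, Set.mem_iUnion]
    exact ⟨fun ⟨n, hn⟩ => ⟨n, n, le_rfl, hn⟩, fun ⟨_, k, _, hk⟩ => ⟨k, hk⟩⟩
  have hmono : Monotone fun n => {ω | ∃ k ≤ n, l < |f k ω|} :=
    fun a b hab ω ⟨k, hk, h⟩ => ⟨k, hk.trans hab, h⟩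
  -- The bound over all times is the supremum of the finite-horizon bounds, to which Doob's
  -- inequality for `f ^ p` at level `l ^ p` applies.
  rw [hunion, hmono.measure_iUnion]
  refine iSup_le fun n => ?_
  have hlp : 0 < l ^ p := by positivity
  set A : Set Ω := {ω | ((l ^ p).toNNReal : ℝ) ≤
    (Finset.range (n + 1)).sup' Finset.nonempty_range_add_one fun k => f k ω ^ p}
  have hmax := maximal_ineq hsub (fun n ω => hp.pow_nonneg (f n ω)) (ε := (l ^ p).toNNReal) n
  have hle : P {ω | ∃ k ≤ n, l < |f k ω|} ≤ P A := by
    refine measure_mono fun ω ⟨k, hk, h⟩ => ?_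
    refine le_trans ?_ (Finset.le_sup' (fun k => f k ω ^ p) (Finset.mem_range_succ_iff.2 hk))
    rw [Real.coe_toNNReal _ hlp.le, ← hp.pow_abs (f k ω)]
    exact pow_le_pow_left₀ hl.le h.le p
  have hint' : ∫ ω in A, f n ω ^ p ∂P ≤ C :=
    (setIntegral_le_integral (hint n) (ae_of_all _ fun ω => hp.pow_nonneg (f n ω))).trans (hC n)
  rw [ENNReal.ofReal_div_of_pos hlp]
  refine hle.trans ((ENNReal.le_div_iff_mul_le (Or.inl ?_) (Or.inl ENNReal.ofReal_ne_top)).2 ?_)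
  · simpa using hlp
  · rw [mul_comm]
    exact hmax.trans (ENNReal.ofReal_le_ofReal hint')

end Martingale

/-! ### Gaussian variables in `L²` -/

/-- Since `|e^{ia} - e^{ib}| ≤ |a - b|` and the `L¹` norm is at most the `L²` norm, the map is
`|x|`-Lipschitz. It serves to carry Gaussian laws over to `L²` limits. -/
theorem continuous_charFun_map_Lp {Ω : Type*} {mΩ : MeasurableSpace Ω} {P : Measure Ω}
    [IsProbabilityMeasure P] (x : ℝ) :
    Continuous fun X : Lp ℝ 2 P => charFun (P.map X) x := by
  have hexp : ∀ a b : ℝ, ‖Complex.exp (a * Complex.I) - Complex.exp (b * Complex.I)‖ ≤ |a - b| := by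
    intro a b
    have h : Complex.exp (a * Complex.I) - Complex.exp (b * Complex.I) =
        Complex.exp (b * Complex.I) * (Complex.exp (Complex.I * ((a - b : ℝ) : ℂ)) - 1) := by
      rw [mul_sub, ← Complex.exp_add, mul_one]
      congr 2
      push_cast
      ring
    rw [h, norm_mul, Complex.norm_exp_ofReal_mul_I, one_mul]
    exact Real.norm_exp_I_mul_ofReal_sub_one_le
  have hrep : ∀ X : Lp ℝ 2 P,
      charFun (P.map X) x = ∫ ω, Complex.exp ((x * X ω : ℝ) * Complex.I) ∂P := by
    intro X
    rw [charFun_apply_real, integral_map (Lp.aestronglyMeasurable X).aemeasurable (by fun_prop)]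
    push_cast
    rfl
  have hint : ∀ X : Lp ℝ 2 P,
      Integrable (fun ω => Complex.exp ((x * X ω : ℝ) * Complex.I)) P := by
    intro X
    refine Integrable.of_bound (C := 1) ?_ (ae_of_all _ fun ω => ?_)
    · have : Continuous fun y : ℝ => Complex.exp ((x * y : ℝ) * Complex.I) := by fun_prop
      exact this.comp_aestronglyMeasurable (Lp.aestronglyMeasurable X)
    · rw [Complex.norm_exp_ofReal_mul_I]
  refine (LipschitzWith.of_dist_le_mul (K := ‖x‖₊) fun X Y => ?_).continuous
  have hL1 : ∫ ω, ‖(X - Y : Lp ℝ 2 P) ω‖ ∂P ≤ ‖X - Y‖ := by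
    rw [integral_norm_eq_lintegral_enorm (Lp.aestronglyMeasurable _),
      ← eLpNorm_one_eq_lintegral_enorm, Lp.norm_def]
    exact ENNReal.toReal_mono (Lp.eLpNorm_ne_top _)
      (eLpNorm_le_eLpNorm_of_exponent_le (by norm_num) (Lp.aestronglyMeasurable _))
  have hXY : Integrable (fun ω => (X - Y : Lp ℝ 2 P) ω) P :=
    (Lp.memLp (X - Y)).integrable (by norm_num)
  rw [hrep, hrep, dist_eq_norm, dist_eq_norm, ← integral_sub (hint X) (hint Y)]
  calc ‖∫ ω, (Complex.exp ((x * X ω : ℝ) * Complex.I) -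
        Complex.exp ((x * Y ω : ℝ) * Complex.I)) ∂P‖
      ≤ ∫ ω, ‖x‖ * ‖(X - Y : Lp ℝ 2 P) ω‖ ∂P := by
        refine norm_integral_le_of_norm_le (hXY.norm.const_mul _) ?_
        filter_upwards [Lp.coeFn_sub X Y] with ω hω
        refine (hexp _ _).trans ?_
        rw [hω, ← mul_sub, abs_mul]
        rfl
    _ ≤ ‖x‖₊ * ‖X - Y‖ := by
        rw [integral_const_mul]
        exact mul_le_mul_of_nonneg_left hL1 (norm_nonneg _)

theorem integral_pow_gaussianReal (p : ℕ) (s : ℝ≥0) :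
    ∫ x, x ^ p ∂(gaussianReal 0 (s ^ 2)) = s ^ p * ∫ x, x ^ p ∂(gaussianReal 0 1) := by
  have h : gaussianReal 0 (s ^ 2) = (gaussianReal 0 1).map ((s : ℝ) * ·) := by
    rw [gaussianReal_map_const_mul]
    congr 1
    · simp
    · ext; simp
  rw [h, integral_map (by fun_prop) (by fun_prop), ← integral_const_mul]
  simp [mul_pow]

/-! ### The Wiener integral as a Gaussian process -/

namespace IsBifractionalBrownianMotion

variable {Ω : Type*} [MeasurableSpace Ω] {α β : ℝ} {B : I → Ω → ℝ} {P : Measure Ω}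

theorem inner_wienerIntegral (hB : IsBifractionalBrownianMotion α β B P) (φ ψ : hB.H) :
    inner ℝ (hB.wienerIntegral φ) (hB.wienerIntegral ψ) = inner ℝ φ ψ :=
  LinearIsometry.inner_map_map
    (⟨hB.wienerIntegral.toLinearMap, hB.norm_wienerIntegral⟩ : hB.H →ₗᵢ[ℝ] Lp ℝ 2 P) φ ψ

/-- The mean is the inner product with the constant `1`, hence continuous and linear in `φ`, and it
vanishes on the indicators. -/
theorem integral_wienerIntegral (hB : IsBifractionalBrownianMotion α β B P) (φ : hB.H) :
    ∫ ω, hB.wienerIntegral φ ω ∂P = 0 := by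
  have := hB.isGaussianProcess.isProbabilityMeasure
  set e : Lp ℝ 2 P := indicatorConstLp 2 MeasurableSet.univ (measure_ne_top P _) (1 : ℝ) with he
  have hmean : ∀ X : Lp ℝ 2 P, inner ℝ e X = ∫ ω, X ω ∂P := fun X => by
    rw [he, L2.inner_indicatorConstLp_one, setIntegral_univ]
  rw [← hmean]
  refine UniformSpace.Completion.induction_on φ
    (isClosed_eq (by fun_prop) continuous_const) fun f => ?_
  rw [wienerIntegral_coe]
  have hz : (innerₛₗ ℝ e).comp hB.stepIntegral = 0 := by
    refine (StepSpace.basis _ hB.posSemidef).ext fun t => ?_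
    simp only [LinearMap.comp_apply, stepIntegral, Module.Basis.constr_basis, innerₛₗ_apply_apply,
      LinearMap.zero_apply]
    rw [hmean, integral_congr_ae (hB.memLp t).coeFn_toLp, hB.centred]
  exact congrArg (fun L => L f) hz

theorem covariance_wienerIntegral (hB : IsBifractionalBrownianMotion α β B P) (φ ψ : hB.H) :
    cov[hB.wienerIntegral φ, hB.wienerIntegral ψ; P] = inner ℝ φ ψ := by
  have := hB.isGaussianProcess.isProbabilityMeasure
  rw [covariance_eq_sub (Lp.memLp _) (Lp.memLp _), hB.integral_wienerIntegral, zero_mul, sub_zero,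
    ← hB.inner_wienerIntegral, L2.inner_def]
  refine integral_congr_ae (ae_of_all _ fun ω => ?_)
  simp [mul_comm]

theorem hasGaussianLaw_stepIntegral (hB : IsBifractionalBrownianMotion α β B P)
    (f : StepSpace (bifractionalKernel α β) hB.posSemidef) :
    HasGaussianLaw (hB.stepIntegral f) P := by
  set c := (StepSpace.basis _ hB.posSemidef).repr f
  refine HasGaussianLaw.congr (X := fun ω => ∑ t ∈ c.support, c t • B t ω)
    (hB.isGaussianProcess.smul c).hasGaussianLaw_fun_sum ?_
  have h : hB.stepIntegral f = ∑ t ∈ c.support, c t • (hB.memLp t).toLp (B t) := by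
    rw [stepIntegral, Module.Basis.constr_apply, Finsupp.sum]
  rw [h]
  refine EventuallyEq.trans ?_ (Lp.coeFn_fun_finsetSum _ _).symm
  have hall : ∀ t ∈ c.support, ∀ᵐ ω ∂P,
      (c t • (hB.memLp t).toLp (B t) : Lp ℝ 2 P) ω = c t • B t ω := by
    intro t _
    filter_upwards [Lp.coeFn_smul (c t) ((hB.memLp t).toLp (B t)), (hB.memLp t).coeFn_toLp]
      with ω h1 h2
    rw [h1, Pi.smul_apply, h2]
  filter_upwards [(Finset.eventually_all c.support).2 hall] with ω hω
  exact Finset.sum_congr rfl fun t ht => (hω t ht).symm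

/-- The Wiener integral of `φ` is a centred Gaussian variable of variance `‖φ‖²`. -/
theorem map_wienerIntegral (hB : IsBifractionalBrownianMotion α β B P) (φ : hB.H) :
    P.map (hB.wienerIntegral φ) = gaussianReal 0 (‖φ‖₊ ^ 2) := by
  have := hB.isGaussianProcess.isProbabilityMeasure
  have hprob : ∀ ψ : hB.H, IsProbabilityMeasure (P.map (hB.wienerIntegral ψ)) := fun ψ =>
    Measure.isProbabilityMeasure_map (Lp.aestronglyMeasurable _).aemeasurable
  have := hprob φ
  refine Measure.ext_of_charFun (funext fun x => ?_)
  rw [charFun_gaussianReal]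
  -- Both characteristic functions depend continuously on `φ`, so it suffices to treat step
  -- functions, whose integrals are finite combinations of values of `B`.
  refine UniformSpace.Completion.induction_on φ (isClosed_eq
    ((continuous_charFun_map_Lp x).comp hB.wienerIntegral.continuous) ?_) fun f => ?_
  · push_cast
    fun_prop
  · rw [← charFun_gaussianReal]
    have hG : HasGaussianLaw (hB.wienerIntegral f) P := by
      rw [wienerIntegral_coe]
      exact hB.hasGaussianLaw_stepIntegral f
    rw [hG.map_eq_gaussianReal, hB.integral_wienerIntegral,
      ← covariance_self (Lp.aestronglyMeasurable _).aemeasurable, hB.covariance_wienerIntegral,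
      real_inner_self_eq_norm_sq]
    congr 2
    ext
    simp

/-- By linearity, every linear functional of finitely many Wiener integrals is almost surely a
single Wiener integral, hence Gaussian. -/
theorem isGaussianProcess_wienerIntegral (hB : IsBifractionalBrownianMotion α β B P) :
    IsGaussianProcess (fun φ : hB.H => ⇑(hB.wienerIntegral φ)) P where
  hasGaussianLaw J := by
    have := hB.isGaussianProcess.isProbabilityMeasure
    have hX : Measurable fun ω => J.restrict fun φ : hB.H => hB.wienerIntegral φ ω :=
      measurable_pi_lambda _ fun φ => (Lp.stronglyMeasurable _).measurable
    refine ⟨isGaussian_of_isGaussian_map fun L => ?_⟩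
    rw [Measure.map_map (by fun_prop) hX]
    classical
    have hae : L ∘ (fun ω => J.restrict fun φ : hB.H => hB.wienerIntegral φ ω) =ᵐ[P]
        hB.wienerIntegral (∑ φ : J, L (Pi.single φ 1) • (φ : hB.H)) := by
      rw [map_sum]
      refine EventuallyEq.trans ?_ (Lp.coeFn_fun_finsetSum _ _).symm
      have hall : ∀ φ : J, ∀ᵐ ω ∂P, hB.wienerIntegral (L (Pi.single φ 1) • (φ : hB.H)) ω =
          L (Pi.single φ 1) * hB.wienerIntegral φ ω := by
        intro φ
        rw [map_smul]
        exact Lp.coeFn_smul _ _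
      filter_upwards [ae_all_iff.2 hall] with ω hω
      simp only [hω, Function.comp_apply]
      conv_lhs => rw [pi_eq_sum_univ' (J.restrict fun φ : hB.H => hB.wienerIntegral φ ω)]
      rw [map_sum]
      refine Finset.sum_congr rfl fun φ _ => ?_
      rw [map_smul, smul_eq_mul, mul_comm]
      rfl
    rw [Measure.map_congr hae, hB.map_wienerIntegral]
    infer_instance

theorem iIndepFun_wienerIntegral (hB : IsBifractionalBrownianMotion α β B P) {φ : ℕ → hB.H}
    (hφ : Orthonormal ℝ φ) : iIndepFun (fun n => ⇑(hB.wienerIntegral (φ n))) P := by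
  -- For jointly Gaussian families zero covariance means independence. The criterion concerns
  -- families of processes, so each variable is regarded as a process indexed by `Unit`.
  have h := (hB.isGaussianProcess_wienerIntegral.comp_right
    fun p : (_ : ℕ) × Unit => φ p.1).iIndepFun_of_covariance_eq_zero
    (X := fun n (_ : Unit) => ⇑(hB.wienerIntegral (φ n)))
    (fun n _ => (Lp.aestronglyMeasurable _).aemeasurable)
    fun m n hmn _ _ => by rw [hB.covariance_wienerIntegral, hφ.2 hmn]
  exact h.comp (fun _ x => x ()) fun _ => measurable_pi_apply ()

end IsBifractionalBrownianMotion

/-! ### Increments of the indicators in `H` -/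

/-- Midpoint concavity of `x ↦ x ^ β`. -/
theorem rpow_add_rpow_le_two_rpow_mul {a b β : ℝ} (ha : 0 ≤ a) (hb : 0 ≤ b) (hβ : 0 ≤ β)
    (hβ1 : β ≤ 1) : a ^ β + b ^ β ≤ 2 * (1 / (2 : ℝ) ^ β * (a + b) ^ β) := by
  have h := (Real.concaveOn_rpow hβ hβ1).2 (Set.mem_Ici.2 ha) (Set.mem_Ici.2 hb)
    (by norm_num : (0 : ℝ) ≤ 1 / 2) (by norm_num : (0 : ℝ) ≤ 1 / 2) (by norm_num)
  simp only [smul_eq_mul] at h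
  rw [← mul_add, ← mul_add, Real.mul_rpow (by norm_num) (by positivity),
    Real.div_rpow (by norm_num) (by norm_num), Real.one_rpow] at h
  linarith

theorem bifractionalKernel_self {α β : ℝ} (h : α * β ≠ 0) (t : I) :
    bifractionalKernel α β t t = (t : ℝ) ^ (2 * α * β) := by
  have ht : 0 ≤ (t : ℝ) := t.2.1
  have h' : 2 * α * β ≠ 0 := by rw [mul_assoc]; exact mul_ne_zero two_ne_zero h
  rw [bifractionalKernel, sub_self, abs_zero, Real.zero_rpow h', sub_zero, ← two_mul,
    Real.mul_rpow (by norm_num) (by positivity), ← Real.rpow_mul ht, ← mul_assoc, one_div,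
    inv_mul_cancel₀ (by positivity), one_mul]

namespace BifractionalHilbert

variable {α β : ℝ} (hR : (bifractionalKernel α β).PosSemidef)

theorem inner_ind (s t : I) : inner ℝ (ind hR s) (ind hR t) = bifractionalKernel α β s t := by
  rw [ind, ind, UniformSpace.Completion.inner_coe, StepSpace.inner_ind]

/-- The squared norm is `s^{2αβ} + t^{2αβ} - 2R(s,t)`. Concavity at `s^{2α}`, `t^{2α}` absorbs the
first two terms into the positive part of `2R`, leaving `2 · 2^{-β} |s - t|^{2αβ}`. -/
theorem norm_ind_sub_sq_le (hα : 0 < α) (hβ : 0 < β) (hβ1 : β ≤ 1) (s t : I) :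
    ‖ind hR s - ind hR t‖ ^ 2 ≤ 2 * (|(s : ℝ) - t| ^ (α * β)) ^ 2 := by
  have hαβ : α * β ≠ 0 := (mul_pos hα hβ).ne'
  rw [norm_sub_sq_real, ← real_inner_self_eq_norm_sq, ← real_inner_self_eq_norm_sq, inner_ind,
    inner_ind, inner_ind, bifractionalKernel_self hαβ, bifractionalKernel_self hαβ,
    bifractionalKernel, abs_sub_comm]
  have hs : 0 ≤ (s : ℝ) := s.2.1
  have ht : 0 ≤ (t : ℝ) := t.2.1
  have h := rpow_add_rpow_le_two_rpow_mul (Real.rpow_nonneg ht (2 * α))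
    (Real.rpow_nonneg hs (2 * α)) hβ.le hβ1
  rw [← Real.rpow_mul hs, ← Real.rpow_mul ht] at h
  have hsq : (|(s : ℝ) - t| ^ (α * β)) ^ 2 = |(s : ℝ) - t| ^ (2 * α * β) := by
    rw [← Real.rpow_natCast, ← Real.rpow_mul (abs_nonneg _)]
    congr 1
    push_cast
    ring
  have hle : 1 / (2 : ℝ) ^ β * |(s : ℝ) - t| ^ (2 * α * β) ≤ |(s : ℝ) - t| ^ (2 * α * β) := by
    refine mul_le_of_le_one_left (by positivity) ?_
    rw [div_le_one (by positivity)]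
    exact Real.one_le_rpow one_le_two hβ.le
  rw [hsq, mul_sub (1 / (2 : ℝ) ^ β)]
  linarith

theorem norm_ind_sub_le (hα : 0 < α) (hβ : 0 < β) (hβ1 : β ≤ 1) (s t : I) :
    ‖ind hR s - ind hR t‖ ≤ √2 * |(s : ℝ) - t| ^ (α * β) := by
  refine le_of_sq_le_sq ?_ (by positivity)
  rw [mul_pow, Real.sq_sqrt (by norm_num)]
  exact norm_ind_sub_sq_le hR hα hβ hβ1 s t

theorem continuous_ind (hα : 0 < α) (hβ : 0 < β) (hβ1 : β ≤ 1) : Continuous (ind hR) := by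
  refine continuous_iff_continuousAt.2 fun t => ?_
  refine tendsto_iff_norm_sub_tendsto_zero.2
    (squeeze_zero (fun _ => norm_nonneg _) (fun s => norm_ind_sub_le hR hα hβ hβ1 s t) ?_)
  have hαβ := mul_pos hα hβ
  have hc : Continuous fun s : I => √2 * |(s : ℝ) - t| ^ (α * β) :=
    continuous_const.mul (Continuous.rpow_const (by fun_prop) fun _ => Or.inr hαβ.le)
  simpa [Real.zero_rpow hαβ.ne'] using hc.tendsto t

end BifractionalHilbert

/-! ### Partial sums of the expansion -/

/-- Bessel's inequality; this is what makes the later moment bounds uniform in `N`. -/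
theorem Orthonormal.norm_sum_inner_smul_le {E : Type*} [NormedAddCommGroup E]
    [InnerProductSpace ℝ E] {φ : ℕ → E} (hφ : Orthonormal ℝ φ) (h : E) (N : ℕ) :
    ‖∑ n ∈ Finset.range N, inner ℝ (φ n) h • φ n‖ ≤ ‖h‖ := by
  refine le_of_sq_le_sq ?_ (norm_nonneg h)
  rw [← real_inner_self_eq_norm_sq, hφ.inner_sum]
  refine le_trans (le_of_eq ?_) (hφ.sum_inner_products_le h (s := Finset.range N))
  refine Finset.sum_congr rfl fun n _ => ?_
  simp [sq]

namespace IsBifractionalBrownianMotion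

variable {Ω : Type*} [MeasurableSpace Ω] {α β : ℝ} {B : I → Ω → ℝ} {P : Measure Ω}

/-- The partial sum `∑_{n < N} ⟨φₙ, h⟩ B(φₙ)` of the expansion of `B(h)`. -/
noncomputable def expansionSum (hB : IsBifractionalBrownianMotion α β B P) (φ : ℕ → hB.H)
    (h : hB.H) (N : ℕ) (ω : Ω) : ℝ :=
  ∑ n ∈ Finset.range N, inner ℝ (φ n) h * hB.wienerIntegral (φ n) ω

theorem partialSum_sub (hB : IsBifractionalBrownianMotion α β B P) (φ : ℕ → hB.H) (N : ℕ) (ω : Ω)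
    (s t : I) : hB.partialSum φ N ω s - hB.partialSum φ N ω t =
      hB.expansionSum φ (hB.ind s - hB.ind t) N ω := by
  simp only [partialSum, expansionSum, inner_sub_right, sub_mul, Finset.sum_sub_distrib]

theorem continuous_partialSum (hB : IsBifractionalBrownianMotion α β B P) (hα : 0 < α)
    (hβ : 0 < β) (hβ1 : β ≤ 1) (φ : ℕ → hB.H) (N : ℕ) (ω : Ω) :
    Continuous (hB.partialSum φ N ω) := by
  have := BifractionalHilbert.continuous_ind hB.posSemidef hα hβ hβ1
  unfold partialSum
  fun_prop

theorem expansionSum_ae_eq (hB : IsBifractionalBrownianMotion α β B P) (φ : ℕ → hB.H)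
    (h : hB.H) (N : ℕ) :
    hB.expansionSum φ h N =ᵐ[P]
      hB.wienerIntegral (∑ n ∈ Finset.range N, inner ℝ (φ n) h • φ n) := by
  rw [map_sum]
  refine EventuallyEq.trans ?_ (Lp.coeFn_fun_finsetSum _ _).symm
  have hall : ∀ n, ∀ᵐ ω ∂P, hB.wienerIntegral (inner ℝ (φ n) h • φ n) ω =
      inner ℝ (φ n) h * hB.wienerIntegral (φ n) ω := by
    intro n
    rw [map_smul]
    exact Lp.coeFn_smul _ _
  filter_upwards [ae_all_iff.2 hall] with ω hω
  simp only [expansionSum, hω]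

theorem martingale_expansionSum (hB : IsBifractionalBrownianMotion α β B P) {φ : ℕ → hB.H}
    (hφ : Orthonormal ℝ φ) (h : hB.H) :
    ∃ 𝒢, Martingale (fun N => hB.expansionSum φ h (N + 1)) 𝒢 P := by
  have := hB.isGaussianProcess.isProbabilityMeasure
  have hm : ∀ n, StronglyMeasurable fun ω => inner ℝ (φ n) h * hB.wienerIntegral (φ n) ω :=
    fun n => (Lp.stronglyMeasurable _).const_mul _
  refine ⟨_, iIndepFun.martingale_sum_range_succ hm ?_ (fun n => ?_) fun n => ?_⟩
  · exact (hB.iIndepFun_wienerIntegral hφ).comp (fun n x => inner ℝ (φ n) h * x)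
      fun n => measurable_const_mul _
  · exact ((Lp.memLp _).integrable (by norm_num)).const_mul _
  · rw [integral_const_mul, hB.integral_wienerIntegral, mul_zero]

theorem integrable_expansionSum_pow (hB : IsBifractionalBrownianMotion α β B P) (φ : ℕ → hB.H)
    (h : hB.H) (N p : ℕ) : Integrable (fun ω => hB.expansionSum φ h N ω ^ p) P := by
  have := hB.isGaussianProcess.isProbabilityMeasure
  have hL : MemLp (hB.expansionSum φ h N) p P :=
    ((hB.isGaussianProcess_wienerIntegral.hasGaussianLaw_eval _).congr
      (hB.expansionSum_ae_eq φ h N).symm).memLp (by simp)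
  refine (integrable_norm_iff (hL.1.pow p)).1 ?_
  simpa only [Pi.pow_apply, norm_pow] using hL.integrable_norm_pow'

/-- The partial sum is a centred Gaussian whose variance is the squared norm of a projection of `h`,
and the `p`-th moment scales as the `p`-th power of the standard deviation. -/
theorem integral_expansionSum_pow_le (hB : IsBifractionalBrownianMotion α β B P) {φ : ℕ → hB.H}
    (hφ : Orthonormal ℝ φ) (h : hB.H) (N : ℕ) {p : ℕ} (hp : Even p) :
    ∫ ω, hB.expansionSum φ h N ω ^ p ∂P ≤ ‖h‖ ^ p * ∫ x, x ^ p ∂(gaussianReal 0 1) := by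
  set ψ := ∑ n ∈ Finset.range N, inner ℝ (φ n) h • φ n
  have hae : (fun ω => hB.expansionSum φ h N ω ^ p) =ᵐ[P] fun ω => hB.wienerIntegral ψ ω ^ p := by
    filter_upwards [hB.expansionSum_ae_eq φ h N] with ω hω
    rw [hω]
  have hmap : ∫ ω, hB.wienerIntegral ψ ω ^ p ∂P = ∫ x, x ^ p ∂(P.map (hB.wienerIntegral ψ)) :=
    (integral_map (Lp.aestronglyMeasurable _).aemeasurable
      (continuous_pow p).aestronglyMeasurable).symm
  rw [integral_congr_ae hae, hmap, hB.map_wienerIntegral, integral_pow_gaussianReal]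
  refine mul_le_mul_of_nonneg_right ?_ (integral_nonneg fun x => hp.pow_nonneg x)
  exact pow_le_pow_left₀ (norm_nonneg _) (hφ.norm_sum_inner_smul_le h N) p

theorem measure_exists_lt_abs_expansionSum_le (hB : IsBifractionalBrownianMotion α β B P)
    {φ : ℕ → hB.H} (hφ : Orthonormal ℝ φ) (h : hB.H) {p : ℕ} (hp : Even p) {l : ℝ} (hl : 0 < l) :
    P {ω | ∃ N, l < |hB.expansionSum φ h N ω|} ≤
      ENNReal.ofReal ((‖h‖ ^ p * ∫ x, x ^ p ∂(gaussianReal 0 1)) / l ^ p) := by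
  have := hB.isGaussianProcess.isProbabilityMeasure
  obtain ⟨𝒢, hM⟩ := hB.martingale_expansionSum hφ h
  refine le_trans (measure_mono ?_) (hM.measure_exists_lt_abs_le hp
    (fun N => hB.integrable_expansionSum_pow φ h _ p)
    (fun N => hB.integral_expansionSum_pow_le hφ h _ hp) hl)
  rintro ω ⟨N, hN⟩
  -- The martingale starts with one summand; the empty sum is zero and never exceeds `l`.
  cases N with
  | zero => simp [expansionSum, hl.not_gt] at hN
  | succ N => exact ⟨N, hN⟩

/-- Boundedness in `L¹` gives an almost sure limit. Completeness of the basis gives convergence in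
`L²` to `B(h)`. Both imply convergence in measure, where limits are unique. -/
theorem ae_tendsto_expansionSum (hB : IsBifractionalBrownianMotion α β B P)
    (φ : HilbertBasis ℕ ℝ hB.H) (h : hB.H) :
    ∀ᵐ ω ∂P, Tendsto (fun N => hB.expansionSum φ h N ω) atTop (𝓝 (hB.wienerIntegral h ω)) := by
  have := hB.isGaussianProcess.isProbabilityMeasure
  obtain ⟨𝒢, hM⟩ := hB.martingale_expansionSum φ.orthonormal h
  have hbdd : ∀ N, eLpNorm (hB.expansionSum φ h (N + 1)) 1 P ≤ ‖h‖₊ := by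
    intro N
    rw [eLpNorm_congr_ae (hB.expansionSum_ae_eq φ h _)]
    refine (eLpNorm_le_eLpNorm_of_exponent_le (by norm_num : (1 : ℝ≥0∞) ≤ 2)
      (Lp.aestronglyMeasurable _)).trans ?_
    rw [← Lp.enorm_def, ← ofReal_norm, hB.norm_wienerIntegral, ofReal_norm]
    have := φ.orthonormal.norm_sum_inner_smul_le h (N + 1)
    exact ENNReal.coe_le_coe.2 this
  have hlim := hM.submartingale.ae_tendsto_limitProcess hbdd
  have hmeas := tendstoInMeasure_of_tendsto_ae
    (fun N => (hM.integrable N).aestronglyMeasurable) hlim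
  have hsum : Tendsto (fun N => ∑ n ∈ Finset.range (N + 1), inner ℝ (φ n) h • φ n) atTop (𝓝 h) := by
    have := (φ.hasSum_repr h).tendsto_sum_nat
    simp only [φ.repr_apply_apply] at this
    exact this.comp (tendsto_add_atTop_nat 1)
  have hmeas' : TendstoInMeasure P (fun N => hB.expansionSum φ h (N + 1)) atTop
      (hB.wienerIntegral h) := by
    refine TendstoInMeasure.congr_left (fun N => (hB.expansionSum_ae_eq φ h (N + 1)).symm) ?_
    exact tendstoInMeasure_of_tendsto_Lp ((hB.wienerIntegral.continuous.tendsto h).comp hsum)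
  filter_upwards [hlim, tendstoInMeasure_ae_unique hmeas hmeas'] with ω h1 h2
  rw [h2] at h1
  exact (tendsto_add_atTop_iff_nat 1).1 h1

theorem ae_tendsto_partialSum (hB : IsBifractionalBrownianMotion α β B P)
    (φ : HilbertBasis ℕ ℝ hB.H) (t : I) :
    ∀ᵐ ω ∂P, Tendsto (fun N => hB.partialSum φ N ω t) atTop (𝓝 (B t ω)) := by
  have hB' := (hB.memLp t).coeFn_toLp
  rw [← hB.wienerIntegral_ind] at hB'
  filter_upwards [hB.ae_tendsto_expansionSum φ (hB.ind t), hB'] with ω h1 h2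
  rw [← h2]
  exact h1

/-- Almost surely, the dyadic increments of all partial sums are eventually at most `q ^ n`, for
every `q > 2 ^ (-αβ)`. -/
theorem ae_eventually_abs_expansionSum_le (hB : IsBifractionalBrownianMotion α β B P)
    (hα : 0 < α) (hβ : 0 < β) (hβ1 : β ≤ 1) {φ : ℕ → hB.H} (hφ : Orthonormal ℝ φ) {q : ℝ}
    (hq : (1 / 2 : ℝ) ^ (α * β) < q) :
    ∀ᵐ ω ∂P, ∀ᶠ n in atTop, ∀ k < 2 ^ n, ∀ N, |hB.expansionSum φ
      (hB.ind (dyadicPoint n k) - hB.ind (dyadicPoint n (k + 1))) N ω| ≤ q ^ n := by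
  set θ : ℝ := (1 / 2 : ℝ) ^ (α * β) with hθ
  have hθ0 : 0 < θ := by positivity
  have hq0 : 0 < q := hθ0.trans hq
  have hθq : θ / q < 1 := (div_lt_one hq0).2 hq
  -- The moment order `p = 2m` is even, and `(θ/q)^p < 1/2` makes the decay beat the `2^n` intervals
  -- of level `n`.
  obtain ⟨m, hm⟩ := exists_pow_lt_of_lt_one (by norm_num : (0 : ℝ) < 1 / 2) hθq
  set p := 2 * m with hp
  have hpe : Even p := even_two_mul m
  have hpq : (θ / q) ^ p < 1 / 2 :=
    (pow_le_pow_of_le_one (by positivity) hθq.le (by omega)).trans_lt hm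
  set c := ∫ x, x ^ p ∂(gaussianReal 0 1)
  have hc0 : 0 ≤ c := integral_nonneg fun x => hpe.pow_nonneg x
  set h : ℕ → ℕ → hB.H := fun n k => hB.ind (dyadicPoint n k) - hB.ind (dyadicPoint n (k + 1))
  have hnorm : ∀ n, ∀ k < 2 ^ n, ‖h n k‖ ≤ √2 * θ ^ n := by
    intro n k hk
    refine (BifractionalHilbert.norm_ind_sub_le hB.posSemidef hα hβ hβ1 _ _).trans ?_
    rw [coe_dyadicPoint hk.le, coe_dyadicPoint (Nat.succ_le_of_lt hk), ← sub_div]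
    push_cast
    rw [sub_add_cancel_left, abs_div, abs_neg, abs_one, abs_of_pos (by positivity)]
    have : (1 / 2 ^ n : ℝ) ^ (α * β) = θ ^ n := by
      rw [hθ, ← Real.rpow_natCast ((1 / 2 : ℝ) ^ (α * β)), ← Real.rpow_mul (by norm_num),
        mul_comm (α * β), Real.rpow_mul (by norm_num) (n : ℝ), Real.rpow_natCast, div_pow, one_pow]
    rw [this]
  set A : ℕ → Set Ω := fun n =>
    ⋃ k ∈ Finset.range (2 ^ n), {ω | ∃ N, q ^ n < |hB.expansionSum φ (h n k) N ω|}
  have hPA : ∀ n, P (A n) ≤ ENNReal.ofReal (√2 ^ p * c * (2 * (θ / q) ^ p) ^ n) := by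
    intro n
    refine (measure_biUnion_finset_le _ _).trans ?_
    refine (Finset.sum_le_card_nsmul _ _ (ENNReal.ofReal (√2 ^ p * c * ((θ / q) ^ p) ^ n))
      fun k hk => ?_).trans (le_of_eq ?_)
    · refine (hB.measure_exists_lt_abs_expansionSum_le hφ _ hpe (pow_pos hq0 n)).trans
        (ENNReal.ofReal_le_ofReal ?_)
      calc ‖h n k‖ ^ p * c / (q ^ n) ^ p ≤ (√2 * θ ^ n) ^ p * c / (q ^ n) ^ p := by
            gcongr
            exact hnorm n k (Finset.mem_range.1 hk)
        _ = √2 ^ p * c * ((θ / q) ^ p) ^ n := by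
            rw [mul_pow, ← pow_mul, ← pow_mul, ← pow_mul, div_pow, mul_comm p n]
            ring
    · rw [Finset.card_range, nsmul_eq_mul, mul_pow, ← ENNReal.ofReal_natCast,
        ← ENNReal.ofReal_mul (by positivity)]
      congr 1
      push_cast
      ring
  -- The bounds form a geometric series of ratio `2 (θ/q)^p < 1`, so Borel–Cantelli applies.
  have hsum : ∑' n, P (A n) ≠ ∞ := by
    refine ne_top_of_le_ne_top ?_ (ENNReal.tsum_le_tsum hPA)
    have hs : Summable fun n : ℕ => √2 ^ p * c * (2 * (θ / q) ^ p) ^ n :=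
      (summable_geometric_of_lt_one (by positivity) (by linarith)).mul_left _
    exact hs.tsum_ofReal_ne_top
  filter_upwards [ae_eventually_notMem hsum] with ω hω
  filter_upwards [hω] with n hn k hk N
  by_contra hcon
  exact hn (Set.mem_biUnion (Finset.mem_coe.2 (Finset.mem_range.2 hk)) ⟨N, not_le.1 hcon⟩)

/-- Almost surely, the partial sums are Hölder continuous with a common constant, for every exponent
smaller than `αβ`. -/
theorem ae_exists_forall_holderWith_partialSum (hB : IsBifractionalBrownianMotion α β B P)
    (hα : 0 < α) (hβ : 0 < β) (hβ1 : β ≤ 1) (φ : HilbertBasis ℕ ℝ hB.H) {r : ℝ≥0} (hr : 0 < r)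
    (hr' : (r : ℝ) < α * β) :
    ∀ᵐ ω ∂P, ∃ C : ℝ≥0, ∀ N, HolderWith C r (hB.partialSum φ N ω) := by
  obtain ⟨C, hC⟩ := exists_holderWith_of_dyadic hr
  set q : ℝ := (1 / 2 : ℝ) ^ (r : ℝ)
  have hq0 : 0 < q := by positivity
  have hev := hB.ae_eventually_abs_expansionSum_le hα hβ hβ1 φ.orthonormal (q := q)
    (Real.rpow_lt_rpow_of_exponent_gt (by norm_num) (by norm_num) hr')
  -- This covers the levels below `n₀`, which Borel–Cantelli leaves out: each increment converges in
  -- `N`, hence is bounded in `N`.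
  have hconv : ∀ᵐ ω ∂P, ∀ n k : ℕ, ∃ b, Tendsto (fun N => hB.expansionSum φ
      (hB.ind (dyadicPoint n k) - hB.ind (dyadicPoint n (k + 1))) N ω) atTop (𝓝 b) := by
    refine ae_all_iff.2 fun n => ae_all_iff.2 fun k => ?_
    filter_upwards [hB.ae_tendsto_expansionSum φ _] with ω hω using ⟨_, hω⟩
  filter_upwards [hev, hconv] with ω h1 h2
  obtain ⟨n₀, hn₀⟩ := eventually_atTop.1 h1
  have hbdd : ∀ n k : ℕ, ∃ K : ℝ≥0, ∀ N, |hB.expansionSum φ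
      (hB.ind (dyadicPoint n k) - hB.ind (dyadicPoint n (k + 1))) N ω| ≤ K := by
    intro n k
    obtain ⟨b, hb⟩ := h2 n k
    obtain ⟨K, hK⟩ := hb.abs.bddAbove_range
    exact ⟨K.toNNReal, fun N => (hK ⟨N, rfl⟩).trans (Real.le_coe_toNNReal K)⟩
  choose K hK using hbdd
  set Q : ℝ≥0 := ⟨q, hq0.le⟩
  -- The summand `1` serves the levels `n ≥ n₀`; the finite sum dominates each remaining ratio `K n
  -- k / Q ^ n`.
  set M : ℝ≥0 := 1 + ∑ n ∈ Finset.range n₀, ∑ k ∈ Finset.range (2 ^ n), K n k / Q ^ n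
  refine ⟨C * M, fun N => hC _ M (hB.continuous_partialSum hα hβ hβ1 φ N ω) fun n k hk => ?_⟩
  rw [Real.dist_eq, hB.partialSum_sub]
  rcases lt_or_ge n n₀ with hn | hn
  · have hle : K n k / Q ^ n ≤ M :=
      calc K n k / Q ^ n ≤ ∑ k ∈ Finset.range (2 ^ n), K n k / Q ^ n :=
            Finset.single_le_sum_of_canonicallyOrdered (f := fun k => K n k / Q ^ n)
              (Finset.mem_range.2 hk)
        _ ≤ ∑ n ∈ Finset.range n₀, ∑ k ∈ Finset.range (2 ^ n), K n k / Q ^ n :=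
            Finset.single_le_sum_of_canonicallyOrdered
              (f := fun n => ∑ k ∈ Finset.range (2 ^ n), K n k / Q ^ n) (Finset.mem_range.2 hn)
        _ ≤ M := le_add_self
    refine (hK n k N).trans ?_
    have hle' : (K n k : ℝ) / q ^ n ≤ M := by exact_mod_cast hle
    exact (div_le_iff₀ (by positivity)).1 hle'
  · refine (hn₀ n hn k hk N).trans (le_mul_of_one_le_left (by positivity) ?_)
    have : 1 ≤ M := le_self_add
    exact_mod_cast this

end IsBifractionalBrownianMotion

theorem mainTheorem3 {Ω : Type*} [MeasurableSpace Ω] (P : Measure Ω) [IsProbabilityMeasure P]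
    (α β : ℝ) (hα : 0 < α ∧ α < 1) (hβ : 0 < β ∧ β ≤ 1) (hαβ : 1 / 2 < α * β)
    (B : I → Ω → ℝ) (hB : IsBifractionalBrownianMotion α β B P)
    (hcont : ∀ᵐ ω ∂P, Continuous fun t => B t ω)
    (φ : HilbertBasis ℕ ℝ hB.H) :
    ∀ᵐ ω ∂P, ∀ γ : ℝ≥0, 0 < γ → (γ : ℝ) < α * β →
      TendstoHolder γ (fun N => hB.partialSum φ N ω) (fun t => B t ω) := by
  -- Rational exponents keep the exceptional set null; each real `γ < αβ` then has a rational `r`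
  -- strictly between it and `αβ`.
  have hhol : ∀ᵐ ω ∂P, ∀ r : ℚ, 0 < r → (r : ℝ) < α * β →
      ∃ C : ℝ≥0, ∀ N, HolderWith C (r : ℝ).toNNReal (hB.partialSum φ N ω) := by
    refine ae_all_iff.2 fun r => ?_
    by_cases hr : 0 < r ∧ (r : ℝ) < α * β
    · have hr0 : (0 : ℝ) < r := by exact_mod_cast hr.1
      filter_upwards [hB.ae_exists_forall_holderWith_partialSum hα.1 hβ.1 hβ.2 φ
        (Real.toNNReal_pos.2 hr0) (by rw [Real.coe_toNNReal _ hr0.le]; exact hr.2)] with ω hω _ _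
      exact hω
    · exact ae_of_all _ fun ω h1 h2 => absurd ⟨h1, h2⟩ hr
  have hlim : ∀ᵐ ω ∂P, ∀ p : ℕ × ℕ,
      Tendsto (fun N => hB.partialSum φ N ω (dyadicPoint p.1 p.2)) atTop
        (𝓝 (B (dyadicPoint p.1 p.2) ω)) :=
    ae_all_iff.2 fun p => hB.ae_tendsto_partialSum φ _
  filter_upwards [hcont, hhol, hlim] with ω hc h1 h2 γ hγ hγαβ
  obtain ⟨r, hγr, hr⟩ := exists_rat_btwn hγαβ
  have hr0 : (0 : ℝ) < r := lt_of_le_of_lt γ.2 hγr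
  obtain ⟨C, hC⟩ := h1 r (by exact_mod_cast hr0) hr
  exact tendstoHolder_of_holderWith dense_range_dyadicPoint hC hγ
    (Real.lt_toNNReal_iff_coe_lt.2 hγr) hc (by rintro _ ⟨p, rfl⟩; exact h2 p)
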